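/- **Setting.** Let $\mathcal X$ (contexts) and $\mathcal A$ (arms) be finite sets, let $\mathbf p=(\mathbf p_x)_{x\in\mathcal X}$ be a probability distribution on $\mathcal X$ with $\mathbf p_x>0$ for every $x$, and let $\Phi\in\mathbb R^{(\mathcal X\times\mathcal A)\times d}$ be a feature matrix whose rows $\phi(x,a)^\top$ span $\mathbb R^d$. A contextual bandit instance has a vector of mean rewards $\mu\in\mathbb R^{\mathcal X\times\mathcal A}$, which need not lie in the range of $\Phi$. For $x\in\mathcal X$, $a\in\mathcal A$ let $\mathcal R^x_a=\{\xi\in\mathbb R^{\mathcal X\times\mathcal A}:\xi_{x,a}>\xi_{x,b}\ \forall b\neq a\}$ and $\Theta^x_a=\{\theta\in\mathbb R^d:\Phi\theta\in\mathcal R^x_a\}$. For a sampling distribution $\alpha$ in the simplex over $\mathcal X\times\mathcal A$ with $\Lambda=\mathrm{diag}(\alpha)$ such that $\Phi^\top\Lambda\Phi$ is invertible, let $$\mathbf P^\Lambda(\xi)=\operatorname*{argmin}_{\theta}\ \sum_{x,a}\alpha(x,a)\,\bigl(\phi(x,a)^\top\theta-\xi_{x,a}\bigr)^2 .$$ Let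 $\mathcal C^x_a$ be the set of all $\xi\in\mathcal R^x_a$ such that $\mathbf P^\Lambda(\xi)\in\Theta^x_a$ for all such $\Lambda$, and let $\mathcal C^{\mathcal X}$ be the set of all $\xi$ which, for every $x\in\mathcal X$, belong to $\mathcal C^x_{\mathrm{OPT}(x)}$, where $\mathrm{OPT}(x)$ is the optimal arm of $\xi$ at $x$. A point $\mu$ is an interior point of $\mathcal C^{\mathcal X}$ if for some $\delta>0$ the cell $\mathbf 1_\delta(\mu)=\{\xi:|\xi_{x,a}-\mu_{x,a}|<\delta\ \forall x,a\}$ is contained in $\mathcal C^{\mathcal X}$. **Algorithm.** In every round $t=1,2,\dots$: a context $X_t\sim\mathbf p$ is drawn independently of the past; with $\hat\theta_t$ any minimizer of $\sum_{s=1}^{t-1}(\phi(X_s,A_s)^\top\theta-Y_s)^2$ over $\theta\in\mathbb R^d$ (computed from the past), the arm $A_t$ is, conditionally on the past and $X_t$, with probability $1-\epsilon_t$ a maximizer of $a\mapsto\phi(X_t,a)^\top\hat\theta_t$ (ties broken arbitrarily), and with probability $\epsilon_t$ uniformly distributed on $\mathcal A$; then the reward $Y_t=\mu_{X_t,A_t}+\eta_t$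 is observed, where the noise is $\tfrac12$-sub-Gaussian: conditionally on the past, $X_t$ and $A_t$, $\mathbb E[e^{\lambda\eta_t}\mid\cdot\,]\le e^{\lambda^2/8}$ for all $\lambda\in\mathbb R$. **Theorem.** Let $\mu$ be an interior point of $\mathcal C^{\mathcal X}$. Then the $\epsilon$-greedy algorithm with $\epsilon_t=1/\sqrt t$ has expected regret $O(\Delta_{\max}\sqrt T)$: for every $\delta>0$ with $\mathbf 1_\delta(\mu)\subset\mathcal C^{\mathcal X}$ and all $T\ge 0$, $$\sum_{t=1}^T\mathbb E\bigl[\Delta_{X_t,A_t}\bigr]\ \le\ C\,\Delta_{\max}\sqrt T,$$ where $\Delta_{x,a}=\max_b\mu_{x,b}-\mu_{x,a}$, $\Delta_{\max}=\max_{x,a}\Delta_{x,a}$, and the constant $C$ depends only on $\mathcal X$, $\mathcal A$, $\mathbf p$ and $\delta$ (and not on $d$, $\Phi$, $\mu$ beyond $\delta$, the reward distributions, or $T$). -/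

import Mathlib

open MeasureTheory ProbabilityTheory
open scoped Matrix

noncomputable section

namespace ContextBandit

/-! ### Mean rewards, greedy regions and robust regions

`𝒳` is the finite set of contexts and `𝒜` the finite set of arms. A feature matrix has one row
for every context-arm pair, and a vector of mean rewards is a function on context-arm pairs. -/

section Regions

variable {𝒳 𝒜 : Type*} {d : ℕ}

/-- The reward vectors for which `a` is the (strictly) optimal arm in context `x`. -/
def greedyRegion (x : 𝒳) (a : 𝒜) : Set (𝒳 × 𝒜 → ℝ) :=
  {ξ | ∀ b, b ≠ a → ξ (x, b) < ξ (x, a)}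

/-- The parameters `θ` whose expressed rewards `Φ θ` make `a` the optimal arm in context `x`. -/
def robustParameterRegion (Φ : Matrix (𝒳 × 𝒜) (Fin d) ℝ) (x : 𝒳) (a : 𝒜) :
    Set (Fin d → ℝ) :=
  {θ | Φ *ᵥ θ ∈ greedyRegion x a}

variable [Fintype 𝒳] [Fintype 𝒜]

/-- `θ` is a model estimate of `ξ` under the weights `α`: it minimizes the `α`-weighted Euclidean
norm of `Φ θ - ξ` (equivalently, the square of that norm). -/
def IsModelEstimate (Φ : Matrix (𝒳 × 𝒜) (Fin d) ℝ) (α ξ : 𝒳 × 𝒜 → ℝ) (θ : Fin d → ℝ) : Prop :=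
  ∀ θ' : Fin d → ℝ,
    ∑ i, α i * ((Φ *ᵥ θ) i - ξ i) ^ 2 ≤ ∑ i, α i * ((Φ *ᵥ θ') i - ξ i) ^ 2

variable [DecidableEq 𝒳] [DecidableEq 𝒜]

/-- The robust observation region of arm `a` at context `x`: arm `a` is optimal at `x`, and for
every sampling distribution `α` with `Φᵀ diag(α) Φ` invertible the model estimate (unique in that
case) lies in the robust parameter region. -/
def robustObservationRegion (Φ : Matrix (𝒳 × 𝒜) (Fin d) ℝ) (x : 𝒳) (a : 𝒜) :
    Set (𝒳 × 𝒜 → ℝ) :=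
  {ξ | ξ ∈ greedyRegion x a ∧
    ∀ α ∈ stdSimplex ℝ (𝒳 × 𝒜), IsUnit (Φᵀ * Matrix.diagonal α * Φ) →
      ∀ θ, IsModelEstimate Φ α ξ θ → θ ∈ robustParameterRegion Φ x a}

/-- The region `C^𝒳 = ⋂ x, C^x_{OPT(x)}`, where `OPT(x)` is the optimal arm of the instance at
context `x`. As `C^x_a` only contains instances whose unique optimal arm at `x` is `a`, this is
membership in `C^x_a` for some arm `a`, for every context `x`. -/
def robustRegion (Φ : Matrix (𝒳 × 𝒜) (Fin d) ℝ) : Set (𝒳 × 𝒜 → ℝ) :=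
  ⋂ x, ⋃ a, robustObservationRegion Φ x a

/-- The open cell of size `δ` centred at `ξ`. -/
def cell (ξ : 𝒳 × 𝒜 → ℝ) (δ : ℝ) : Set (𝒳 × 𝒜 → ℝ) :=
  {ζ | ∀ i, ζ i ∈ Set.Ioo (ξ i - δ) (ξ i + δ)}

/-- The interior points of the robust region. -/
def robustInterior (Φ : Matrix (𝒳 × 𝒜) (Fin d) ℝ) : Set (𝒳 × 𝒜 → ℝ) :=
  {ξ | ∃ δ, 0 < δ ∧ cell ξ δ ⊆ robustRegion Φ}

end Regions

/-! ### Regret -/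

section Regret

variable {𝒳 𝒜 Ω : Type*}

/-- The sub-optimality gap of arm `a` in context `x`. -/
def gap (μ : 𝒳 × 𝒜 → ℝ) (x : 𝒳) (a : 𝒜) : ℝ := (⨆ b, μ (x, b)) - μ (x, a)

/-- The largest sub-optimality gap. -/
def maxGap (μ : 𝒳 × 𝒜 → ℝ) : ℝ := ⨆ i : 𝒳 × 𝒜, gap μ i.1 i.2

/-- The expected cumulative regret over the rounds `1, …, T`. -/
def regret [MeasurableSpace Ω] (P : Measure Ω) (μ : 𝒳 × 𝒜 → ℝ)
    (X : ℕ → Ω → 𝒳) (A : ℕ → Ω → 𝒜) (T : ℕ) : ℝ :=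
  ∑ t ∈ Finset.Icc 1 T, ∫ ω, gap μ (X t ω) (A t ω) ∂P

end Regret

/-! ### The interaction of the `ε`-greedy algorithm with a contextual bandit -/

section Interaction

variable {𝒳 𝒜 Ω : Type*} [MeasurableSpace 𝒳] [MeasurableSpace 𝒜] [mΩ : MeasurableSpace Ω]

/-- The information before the arm of round `n + 1` is drawn: the past and the new context. -/
abbrev infoBeforeAction (ℱ : Filtration ℕ mΩ) (X : ℕ → Ω → 𝒳) (n : ℕ) : MeasurableSpace Ω :=
  ℱ n ⊔ MeasurableSpace.comap (X (n + 1)) inferInstance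

/-- The information before the reward of round `n + 1` is drawn: the past, the new context and
the arm that is played. -/
abbrev infoBeforeReward (ℱ : Filtration ℕ mΩ) (X : ℕ → Ω → 𝒳) (A : ℕ → Ω → 𝒜) (n : ℕ) :
    MeasurableSpace Ω :=
  infoBeforeAction ℱ X n ⊔ MeasurableSpace.comap (A (n + 1)) inferInstance

/-- `η` is conditionally `R`-sub-Gaussian (hence conditionally centred) given `m`. -/
def IsCondSubGaussian (P : Measure Ω) (m : MeasurableSpace Ω) (η : Ω → ℝ) (R : ℝ) : Prop :=
  ∀ l : ℝ, Integrable (fun ω => Real.exp (l * η ω)) P ∧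
    ∀ᵐ ω ∂P, (P[fun ω' => Real.exp (l * η ω') | m]) ω ≤ Real.exp (l ^ 2 * R ^ 2 / 2)

variable [Fintype 𝒜] [DecidableEq 𝒜] {d : ℕ}

/-- The processes `X` (contexts), `A` (arms), `Y` (rewards), `θ` (least-squares estimates) and `G`
(greedy arms) form a run of the `ε`-greedy algorithm with exploration probabilities `ε` on a
contextual bandit with features `Φ`, mean rewards `μ`, context distribution `p` and
`R`-sub-Gaussian reward noise. The rounds are `1, 2, 3, …`, the index `0` of the processes is not
used, and `ℱ n` is the information after round `n`. -/
structure IsEpsGreedyRun (P : Measure Ω) (ℱ : Filtration ℕ mΩ)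
    (Φ : Matrix (𝒳 × 𝒜) (Fin d) ℝ) (μ : 𝒳 × 𝒜 → ℝ) (p : 𝒳 → ℝ) (R : ℝ) (ε : ℕ → ℝ)
    (X : ℕ → Ω → 𝒳) (A : ℕ → Ω → 𝒜) (Y : ℕ → Ω → ℝ)
    (θ : ℕ → Ω → (Fin d → ℝ)) (G : ℕ → Ω → 𝒜) : Prop where
  measurable_context : ∀ n, Measurable[ℱ (n + 1)] (X (n + 1))
  measurable_arm : ∀ n, Measurable[ℱ (n + 1)] (A (n + 1))
  measurable_reward : ∀ n, Measurable[ℱ (n + 1)] (Y (n + 1))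
  measurable_estimate : ∀ n, Measurable[ℱ n] (θ (n + 1))
  measurable_greedy : ∀ n, Measurable[infoBeforeAction ℱ X n] (G (n + 1))
  /-- The context of a round is independent of the past. -/
  context_indep : ∀ n, Indep (MeasurableSpace.comap (X (n + 1)) inferInstance) (ℱ n) P
  /-- The context of a round has distribution `p`. -/
  context_law : ∀ n x, P.real (X (n + 1) ⁻¹' {x}) = p x
  /-- The estimate used in round `n + 1` is a least-squares fit to the first `n` rounds (any
  minimizer, if there are several). -/
  estimate : ∀ n, ∀ᵐ ω ∂P, ∀ θ' : Fin d → ℝ,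
    ∑ s ∈ Finset.Icc 1 n, ((Φ *ᵥ θ (n + 1) ω) (X s ω, A s ω) - Y s ω) ^ 2 ≤
      ∑ s ∈ Finset.Icc 1 n, ((Φ *ᵥ θ') (X s ω, A s ω) - Y s ω) ^ 2
  /-- The greedy arm maximizes the estimated reward in the current context (ties are broken
  arbitrarily). -/
  greedy : ∀ n, ∀ᵐ ω ∂P, ∀ b,
    (Φ *ᵥ θ (n + 1) ω) (X (n + 1) ω, b) ≤ (Φ *ᵥ θ (n + 1) ω) (X (n + 1) ω, G (n + 1) ω)
  /-- Given the past and the current context, the greedy arm is played with probability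
  `1 - ε (n + 1)` and a uniformly random arm with probability `ε (n + 1)`. -/
  arm_law : ∀ n a, ∀ᵐ ω ∂P,
    (P⟦A (n + 1) ⁻¹' {a} | infoBeforeAction ℱ X n⟧) ω =
      (1 - ε (n + 1)) * (if G (n + 1) ω = a then 1 else 0) + ε (n + 1) / Fintype.card 𝒜
  /-- Given the past, the current context and the arm, the reward is the mean reward of the
  context-arm pair plus centred sub-Gaussian noise. -/
  reward_law : ∀ n, IsCondSubGaussian P (infoBeforeReward ℱ X A n)
    (fun ω => Y (n + 1) ω - μ (X (n + 1) ω, A (n + 1) ω)) R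

end Interaction

end ContextBandit

end

/-! Pooling the observations of each context-arm pair turns ordinary least squares into weighted
least squares fitted to the vector of empirical means, with the visit frequencies as weights
(`sum_sq_residual`). Once every pair has been visited and every empirical mean is within `δ` of `μ`,
that vector lies in the cell, the weights form an admissible sampling distribution, and robustness
makes the greedy arm optimal despite misspecification (`estimate_mem_robustParameterRegion`).

It remains to bound the probability that a pair is unvisited or badly estimated. With `N` visits and
accumulated noise `S`, the mean of `exp (l * S - |l| * δ * N)` shrinks in each round: a visit has
conditional probability at least `p x * ε / |𝒜|` and multiplies the mean by at most `exp (l ^ 2 / 8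
- |l| * δ)`. Visits and noise are thus controlled together, without a separate bound on the random
`N` (`lintegral_step_le`, `measureReal_deviation_le`). Since `∑ ε` grows like `√n`, the failure
probability is at most a constant times `1 / √n`, the same order as exploration itself. Summing over
rounds gives `√T`. -/

namespace ContextBandit

/-! ### Least squares through empirical means. -/

section Deterministic

variable {ι : Type*} [DecidableEq ι]

/-- The number of rounds `1, …, n` in which `i` is observed. -/
def visits (I : ℕ → ι) (n : ℕ) (i : ι) : ℝ := ∑ s ∈ Finset.Icc 1 n, if I s = i then 1 else 0

/-- The accumulated deviation from `μ i` of the observations of `i` in the rounds `1, …, n`. -/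
def noiseSum (μ : ι → ℝ) (I : ℕ → ι) (y : ℕ → ℝ) (n : ℕ) (i : ι) : ℝ :=
  ∑ s ∈ Finset.Icc 1 n, if I s = i then y s - μ i else 0

/-- The empirical mean of the observations of `i` in the rounds `1, …, n`. -/
noncomputable def empiricalMean (μ : ι → ℝ) (I : ℕ → ι) (y : ℕ → ℝ) (n : ℕ) (i : ι) : ℝ :=
  μ i + noiseSum μ I y n i / visits I n i

theorem visits_nonneg (I : ℕ → ι) (n : ℕ) (i : ι) : 0 ≤ visits I n i :=
  Finset.sum_nonneg fun s _ => by split_ifs <;> norm_num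

variable [Fintype ι]

theorem sum_visits (I : ℕ → ι) (n : ℕ) : ∑ i, visits I n i = n := by
  simp only [visits]
  rw [Finset.sum_comm]
  simp

theorem sum_visits_mul (I : ℕ → ι) (n : ℕ) (f : ι → ℝ) :
    ∑ i, visits I n i * f i = ∑ s ∈ Finset.Icc 1 n, f (I s) := by
  simp only [visits, Finset.sum_mul, ite_mul, one_mul, zero_mul]
  rw [Finset.sum_comm]
  simp

/-- Residuals about an empirical mean cancel within each class `I s = i`, and `f` is constant on
such a class. -/
theorem sum_mul_residual_eq_zero (μ : ι → ℝ) (I : ℕ → ι) (y : ℕ → ℝ) (n : ℕ)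
    (hN : ∀ i, 0 < visits I n i) (f : ι → ℝ) :
    ∑ s ∈ Finset.Icc 1 n, f (I s) * (empiricalMean μ I y n (I s) - y s) = 0 := by
  have h1 : ∀ i, ∑ s ∈ Finset.Icc 1 n,
      (if I s = i then f i * (empiricalMean μ I y n i - y s) else 0) = 0 := by
    intro i
    have : ∀ s, (if I s = i then f i * (empiricalMean μ I y n i - y s) else 0) =
        f i * ((empiricalMean μ I y n i - μ i) * (if I s = i then 1 else 0) -
          (if I s = i then y s - μ i else 0)) := by
      intro s; split_ifs <;> ring
    simp only [this]
    rw [← Finset.mul_sum, Finset.sum_sub_distrib, ← Finset.mul_sum]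
    change f i * ((empiricalMean μ I y n i - μ i) * visits I n i - noiseSum μ I y n i) = 0
    have := (hN i).ne'
    rw [empiricalMean]
    field_simp
    ring
  calc _ = ∑ s ∈ Finset.Icc 1 n, ∑ i,
      (if I s = i then f i * (empiricalMean μ I y n i - y s) else 0) := by simp
    _ = 0 := by rw [Finset.sum_comm]; simp [h1]

/-- Pythagoras. The last sum does not involve `v`, so both losses have the same minimizers in any
class of `v`. -/
theorem sum_sq_residual (μ : ι → ℝ) (I : ℕ → ι) (y : ℕ → ℝ) (n : ℕ)
    (hN : ∀ i, 0 < visits I n i) (v : ι → ℝ) :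
    ∑ s ∈ Finset.Icc 1 n, (v (I s) - y s) ^ 2 =
      ∑ i, visits I n i * (v i - empiricalMean μ I y n i) ^ 2 +
        ∑ s ∈ Finset.Icc 1 n, (empiricalMean μ I y n (I s) - y s) ^ 2 := by
  have h := sum_mul_residual_eq_zero μ I y n hN (fun i => 2 * (v i - empiricalMean μ I y n i))
  rw [sum_visits_mul I n (fun i => (v i - empiricalMean μ I y n i) ^ 2),
    ← add_zero (∑ s ∈ _, (empiricalMean μ I y n (I s) - y s) ^ 2), ← h,
    ← Finset.sum_add_distrib, ← Finset.sum_add_distrib]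
  exact Finset.sum_congr rfl fun s _ => by ring

end Deterministic

/-! ### From accurate empirical means to an optimal greedy arm. -/

section Geometry

variable {𝒳 𝒜 : Type*} {d : ℕ}

theorem mem_cell_self (μ : 𝒳 × 𝒜 → ℝ) {δ : ℝ} (hδ : 0 < δ) : μ ∈ cell μ δ :=
  fun i => ⟨by linarith, by linarith⟩

variable [Fintype 𝒳] [Fintype 𝒜]

/-- A kernel vector has zero quadratic form, so it is orthogonal to every row of `Φ`, hence to their
span and to itself. -/
theorem isUnit_gram (Φ : Matrix (𝒳 × 𝒜) (Fin d) ℝ) [DecidableEq 𝒳] [DecidableEq 𝒜]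
    (hΦ : Submodule.span ℝ (Set.range Φ.row) = ⊤)
    (α : 𝒳 × 𝒜 → ℝ) (hα : ∀ i, 0 < α i) : IsUnit (Φᵀ * Matrix.diagonal α * Φ) := by
  rw [← Matrix.mulVec_injective_iff_isUnit, ← Matrix.coe_mulVecLin, ← LinearMap.ker_eq_bot,
    LinearMap.ker_eq_bot']
  intro v hv
  rw [Matrix.mulVecLin_apply] at hv
  have hq : ∑ i, α i * (Φ *ᵥ v) i ^ 2 = 0 := by
    have : v ⬝ᵥ ((Φᵀ * Matrix.diagonal α * Φ) *ᵥ v) = 0 := by rw [hv, dotProduct_zero]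
    rw [← Matrix.mulVec_mulVec, ← Matrix.mulVec_mulVec, Matrix.dotProduct_mulVec,
      Matrix.vecMul_transpose] at this
    rw [← this]
    simp only [dotProduct, Matrix.mulVec_diagonal]
    exact Finset.sum_congr rfl fun i _ => by ring
  have h0 : ∀ i, (Φ *ᵥ v) i = 0 := by
    intro i
    have := (Finset.sum_eq_zero_iff_of_nonneg
      (fun i _ => mul_nonneg (hα i).le (sq_nonneg _))).1 hq i (Finset.mem_univ i)
    simpa [(hα i).ne'] using this
  have hle : Submodule.span ℝ (Set.range Φ.row) ≤
      LinearMap.ker (dotProductBilin ℝ ℝ v) := by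
    rw [Submodule.span_le]
    rintro _ ⟨i, rfl⟩
    have := h0 i
    simp only [SetLike.mem_coe, LinearMap.mem_ker, dotProductBilin_apply_apply]
    rw [dotProduct_comm]
    exact this
  have hvv : v ∈ LinearMap.ker (dotProductBilin ℝ ℝ v) := hle (by rw [hΦ]; trivial)
  exact dotProduct_self_eq_zero.1 (by simpa using hvv)

variable [DecidableEq 𝒳] [DecidableEq 𝒜]

/-- Inside the robust region the optimal arm is separated from the others by twice the size of
the cell: otherwise the cell contains an instance with a tie. -/
theorem two_mul_le_sub_of_cell_subset {Φ : Matrix (𝒳 × 𝒜) (Fin d) ℝ} {μ : 𝒳 × 𝒜 → ℝ} {δ : ℝ}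
    (hδ : 0 < δ) (hcell : cell μ δ ⊆ robustRegion Φ) {x : 𝒳} {a : 𝒜} (ha : μ ∈ greedyRegion x a)
    {b : 𝒜} (hb : b ≠ a) : 2 * δ ≤ μ (x, a) - μ (x, b) := by
  by_contra! hlt
  -- The tie is made with the runner-up `c`: both arms move by less than `δ` to their midpoint, and
  -- no third arm reaches it, so no arm is strictly optimal.
  obtain ⟨c, hc, hmax⟩ := Finset.exists_max_image (Finset.univ.erase a) (fun b => μ (x, b))
    ⟨b, by simpa using hb⟩
  have hca : c ≠ a := by simpa using hc
  have hbc : μ (x, b) ≤ μ (x, c) := hmax b (by simpa using hb)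
  have hac : μ (x, c) < μ (x, a) := ha c hca
  set ζ : 𝒳 × 𝒜 → ℝ := fun i =>
    if i = (x, a) ∨ i = (x, c) then (μ (x, a) + μ (x, c)) / 2 else μ i with hζ
  have hmem : ζ ∈ cell μ δ := by
    intro i
    simp only [hζ]
    split_ifs with h
    · rcases h with rfl | rfl <;> constructor <;> linarith
    · constructor <;> linarith
  obtain ⟨e, he, -⟩ := Set.mem_iUnion.1 (Set.mem_iInter.1 (hcell hmem) x)
  have hζa : ζ (x, a) = (μ (x, a) + μ (x, c)) / 2 := by simp [hζ]
  have hζc : ζ (x, c) = (μ (x, a) + μ (x, c)) / 2 := by simp [hζ]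
  by_cases hea : e = a
  · subst hea
    have := he c hca
    linarith
  · have h1 := he a (Ne.symm hea)
    by_cases hec : e = c
    · subst hec; linarith
    · have hζe : ζ (x, e) = μ (x, e) := by simp [hζ, hea, hec]
      have := hmax e (by simpa using hea)
      linarith

theorem estimate_mem_robustParameterRegion {Φ : Matrix (𝒳 × 𝒜) (Fin d) ℝ}
    (hΦ : Submodule.span ℝ (Set.range Φ.row) = ⊤) {μ : 𝒳 × 𝒜 → ℝ} {δ : ℝ}
    (hδ : 0 < δ) (hcell : cell μ δ ⊆ robustRegion Φ) {x : 𝒳} {a : 𝒜} (ha : μ ∈ greedyRegion x a)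
    {I : ℕ → 𝒳 × 𝒜} {y : ℕ → ℝ} {n : ℕ}
    (hgood : ∀ i, |noiseSum μ I y n i| < δ * visits I n i) {θ : Fin d → ℝ}
    (hθ : ∀ θ' : Fin d → ℝ, ∑ s ∈ Finset.Icc 1 n, ((Φ *ᵥ θ) (I s) - y s) ^ 2 ≤
      ∑ s ∈ Finset.Icc 1 n, ((Φ *ᵥ θ') (I s) - y s) ^ 2) :
    θ ∈ robustParameterRegion Φ x a := by
  -- Strictness in `hgood` already rules out unvisited pairs.
  have hN : ∀ i, 0 < visits I n i := fun i =>
    pos_of_mul_pos_right ((abs_nonneg _).trans_lt (hgood i)) hδ.le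
  have hn : (0 : ℝ) < n := by
    rw [← sum_visits I n]
    exact Finset.sum_pos (fun i _ => hN i) ⟨(x, a), Finset.mem_univ _⟩
  have hmem : empiricalMean μ I y n ∈ cell μ δ := by
    intro i
    have : |noiseSum μ I y n i / visits I n i| < δ := by
      rw [abs_div, abs_of_pos (hN i), div_lt_iff₀ (hN i)]
      exact hgood i
    rw [abs_lt] at this
    unfold empiricalMean
    constructor <;> linarith [this.1, this.2]
  obtain ⟨e, he, hrob⟩ := Set.mem_iUnion.1 (Set.mem_iInter.1 (hcell hmem) x)
  -- The optimal arm of the empirical means is that of `μ`: a gap of `2 * δ` survives perturbations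
  -- smaller than `δ`.
  have hea : e = a := by
    by_contra hne
    have h1 := two_mul_le_sub_of_cell_subset hδ hcell ha hne
    have h2 := he a (Ne.symm hne)
    have h3 := (hmem (x, a)).1
    have h4 := (hmem (x, e)).2
    linarith
  subst hea
  refine hrob (fun i => visits I n i / n) ⟨fun i => (div_pos (hN i) hn).le, ?_⟩
    (isUnit_gram Φ hΦ _ fun i => div_pos (hN i) hn) θ fun θ' => ?_
  · rw [← Finset.sum_div, sum_visits, div_self hn.ne']
  · have h := hθ θ'
    rw [sum_sq_residual μ I y n hN (Φ *ᵥ θ), sum_sq_residual μ I y n hN (Φ *ᵥ θ')] at h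
    simp only [div_mul_eq_mul_div, ← Finset.sum_div]
    exact div_le_div_of_nonneg_right (by linarith) hn.le

end Geometry

/-! ### Elementary bounds on gaps. -/

section Gap

variable {𝒳 𝒜 : Type*} [Finite 𝒜] (μ : 𝒳 × 𝒜 → ℝ)

theorem gap_nonneg (x : 𝒳) (a : 𝒜) : 0 ≤ gap μ x a :=
  sub_nonneg.2 (le_ciSup (f := fun b => μ (x, b)) (Set.finite_range _).bddAbove a)

theorem gap_le_maxGap [Finite 𝒳] (x : 𝒳) (a : 𝒜) : gap μ x a ≤ maxGap μ :=
  le_ciSup (f := fun i : 𝒳 × 𝒜 => gap μ i.1 i.2) (Set.finite_range _).bddAbove (x, a)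

theorem maxGap_nonneg : 0 ≤ maxGap μ :=
  Real.iSup_nonneg fun i => gap_nonneg μ i.1 i.2

variable {μ}

theorem gap_eq_zero {x : 𝒳} {a : 𝒜} (ha : μ ∈ greedyRegion x a) : gap μ x a = 0 := by
  have : Nonempty 𝒜 := ⟨a⟩
  refine le_antisymm (sub_nonpos.2 (ciSup_le fun b => ?_)) (gap_nonneg μ x a)
  by_cases hb : b = a
  · rw [hb]
  · exact (ha b hb).le

end Gap

/-! ### Conditional bounds as comparisons of measures on a sub-σ-algebra. -/

section Conditional

variable {Ω : Type*} {m mΩ : MeasurableSpace Ω} {P : Measure Ω}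

/-- An `m`-measurable integrand sees a measure only through its trim to `m`. This gives conditional
estimates for nonnegative `f` with no integrability requirement. -/
theorem lintegral_le_of_measure_le (hm : m ≤ mΩ) {ν₁ ν₂ : Measure Ω}
    (h : ∀ s, MeasurableSet[m] s → ν₁ s ≤ ν₂ s) {f : Ω → ENNReal} (hf : Measurable[m] f) :
    ∫⁻ ω, f ω ∂ν₁ ≤ ∫⁻ ω, f ω ∂ν₂ := by
  rw [← lintegral_trim hm hf, ← lintegral_trim hm hf]
  refine lintegral_mono' ?_ le_rfl
  rw [Measure.le_iff]
  intro s hs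
  rw [trim_measurableSet_eq hm hs, trim_measurableSet_eq hm hs]
  exact h s hs

variable [IsProbabilityMeasure P]

theorem lintegral_mul_le_of_condExp_le (hm : m ≤ mΩ) {g : Ω → ℝ} (hg : Integrable g P)
    (hg0 : ∀ ω, 0 ≤ g ω) {c : ℝ} (hc : ∀ᵐ ω ∂P, (P[g | m]) ω ≤ c)
    {f : Ω → ENNReal} (hf : Measurable[m] f) :
    ∫⁻ ω, f ω * ENNReal.ofReal (g ω) ∂P ≤ ENNReal.ofReal c * ∫⁻ ω, f ω ∂P := by
  have hc0 : 0 ≤ c := by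
    have h1 : 0 ≤ᵐ[P] P[g | m] := condExp_nonneg (.of_forall hg0)
    obtain ⟨ω, h2, h3⟩ := (h1.and hc).exists
    exact h2.trans h3
  have h := lintegral_le_of_measure_le (ν₁ := P.withDensity fun ω => ENNReal.ofReal (g ω))
    (ν₂ := ENNReal.ofReal c • P) hm (fun s hs => ?_) hf
  · rw [lintegral_withDensity_eq_lintegral_mul₀ hg.1.aemeasurable.ennreal_ofReal
      (hf.mono hm le_rfl).aemeasurable, lintegral_smul_measure, smul_eq_mul] at h
    refine le_trans (le_of_eq (lintegral_congr fun ω => ?_)) h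
    simp [mul_comm]
  · rw [withDensity_apply _ (hm s hs), ← ofReal_integral_eq_lintegral_ofReal hg.integrableOn
      (.of_forall hg0), ← setIntegral_condExp hm hg hs, Measure.smul_apply, smul_eq_mul,
      ← ofReal_measureReal, ← ENNReal.ofReal_mul hc0]
    refine ENNReal.ofReal_le_ofReal ?_
    calc ∫ ω in s, (P[g | m]) ω ∂P ≤ ∫ _ in s, c ∂P :=
          setIntegral_mono_ae integrable_condExp.integrableOn integrableOn_const hc
      _ = c * P.real s := by simp [mul_comm]

theorem mul_measureReal_le_of_le_condExp (hm : m ≤ mΩ) {B s : Set Ω} (hB : MeasurableSet B)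
    (hs : MeasurableSet[m] s) {c : ℝ} (hc : ∀ᵐ ω ∂P, ω ∈ s → c ≤ (P⟦B | m⟧) ω) :
    c * P.real s ≤ P.real (s ∩ B) := by
  have hg : Integrable (B.indicator fun _ => (1 : ℝ)) P := (integrable_const 1).indicator hB
  calc c * P.real s = ∫ _ in s, c ∂P := by simp [mul_comm]
    _ ≤ ∫ ω in s, (P⟦B | m⟧) ω ∂P :=
        setIntegral_mono_on_ae integrableOn_const integrable_condExp.integrableOn (hm s hs) hc
    _ = ∫ ω in s, B.indicator (fun _ => (1 : ℝ)) ω ∂P := setIntegral_condExp hm hg hs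
    _ = P.real (s ∩ B) := by
        rw [setIntegral_indicator hB]; simp

theorem mul_lintegral_le_setLIntegral (hm : m ≤ mΩ) {B : Set Ω} {c : ℝ}
    (hc0 : 0 ≤ c) (hc : ∀ s, MeasurableSet[m] s → c * P.real s ≤ P.real (s ∩ B))
    {f : Ω → ENNReal} (hf : Measurable[m] f) :
    ENNReal.ofReal c * ∫⁻ ω, f ω ∂P ≤ ∫⁻ ω in B, f ω ∂P := by
  have h := lintegral_le_of_measure_le (ν₁ := ENNReal.ofReal c • P) (ν₂ := P.restrict B) hm
    (fun s hs => ?_) hf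
  · rwa [lintegral_smul_measure, smul_eq_mul] at h
  · rw [Measure.restrict_apply (hm s hs), Measure.smul_apply, smul_eq_mul, ← ofReal_measureReal,
      ← ofReal_measureReal, ← ENNReal.ofReal_mul hc0]
    exact ENNReal.ofReal_le_ofReal (hc s hs)

end Conditional

/-- The exponent of the supermartingale for the observations of `i`. -/
def tilt {ι : Type*} [DecidableEq ι] (μ : ι → ℝ) (δ l : ℝ) (I : ℕ → ι) (y : ℕ → ℝ) (n : ℕ)
    (i : ι) : ℝ :=
  ∑ s ∈ Finset.Icc 1 n, if I s = i then l * (y s - μ i) - |l| * δ else 0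

theorem tilt_eq {ι : Type*} [DecidableEq ι] (μ : ι → ℝ) (δ l : ℝ) (I : ℕ → ι) (y : ℕ → ℝ)
    (n : ℕ) (i : ι) :
    tilt μ δ l I y n i = l * noiseSum μ I y n i - |l| * δ * visits I n i := by
  simp only [tilt, noiseSum, visits, Finset.mul_sum, ← Finset.sum_sub_distrib]
  exact Finset.sum_congr rfl fun s _ => by split_ifs <;> ring

theorem measurableSet_pair {𝒳 𝒜 Ω : Type*} [MeasurableSpace 𝒳] [DiscreteMeasurableSpace 𝒳]
    [MeasurableSpace 𝒜] [DiscreteMeasurableSpace 𝒜] [mΩ : MeasurableSpace Ω]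
    (ℱ : Filtration ℕ mΩ) (X : ℕ → Ω → 𝒳) (A : ℕ → Ω → 𝒜) (n : ℕ) (i : 𝒳 × 𝒜) :
    MeasurableSet[infoBeforeReward ℱ X A n] {ω | (X (n + 1) ω, A (n + 1) ω) = i} := by
  have h1 : MeasurableSet[infoBeforeReward ℱ X A n] (X (n + 1) ⁻¹' {i.1}) :=
    (le_sup_right.trans le_sup_left : MeasurableSpace.comap (X (n + 1)) inferInstance ≤ _) _
      ⟨{i.1}, .of_discrete, rfl⟩
  have h2 : MeasurableSet[infoBeforeReward ℱ X A n] (A (n + 1) ⁻¹' {i.2}) :=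
    (le_sup_right : MeasurableSpace.comap (A (n + 1)) inferInstance ≤ _) _
      ⟨{i.2}, .of_discrete, rfl⟩
  convert h1.inter h2 using 1
  ext ω
  simp [Prod.ext_iff]

/-! ### Probability estimates along a run. -/

section Run

variable {𝒳 𝒜 Ω : Type*} [MeasurableSpace 𝒳] [MeasurableSpace 𝒜] [Fintype 𝒜] [DecidableEq 𝒜]
  {d : ℕ} [mΩ : MeasurableSpace Ω] {P : Measure Ω}
  {ℱ : Filtration ℕ mΩ} {Φ : Matrix (𝒳 × 𝒜) (Fin d) ℝ} {μ : 𝒳 × 𝒜 → ℝ} {p : 𝒳 → ℝ}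
  {ε : ℕ → ℝ} {R : ℝ} {X : ℕ → Ω → 𝒳} {A : ℕ → Ω → 𝒜} {Y : ℕ → Ω → ℝ}
  {θ : ℕ → Ω → (Fin d → ℝ)} {G : ℕ → Ω → 𝒜}

namespace IsEpsGreedyRun

theorem infoBeforeAction_le (h : IsEpsGreedyRun P ℱ Φ μ p R ε X A Y θ G) (n : ℕ) :
    infoBeforeAction ℱ X n ≤ mΩ :=
  sup_le (ℱ.le n) ((h.measurable_context n).comap_le.trans (ℱ.le _))

theorem infoBeforeReward_le (h : IsEpsGreedyRun P ℱ Φ μ p R ε X A Y θ G) (n : ℕ) :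
    infoBeforeReward ℱ X A n ≤ mΩ :=
  sup_le (h.infoBeforeAction_le n) ((h.measurable_arm n).comap_le.trans (ℱ.le _))

/-- Off the union of the bad events the optimal arm strictly maximizes the fitted reward, so neither
tie-breaking nor the choice of minimizer matters. -/
theorem measureReal_greedy_ne_le [Fintype 𝒳] [DecidableEq 𝒳] [IsProbabilityMeasure P]
    (h : IsEpsGreedyRun P ℱ Φ μ p R ε X A Y θ G)
    (hΦ : Submodule.span ℝ (Set.range Φ.row) = ⊤) {δ : ℝ} (hδ : 0 < δ)
    (hcell : cell μ δ ⊆ robustRegion Φ) {o : 𝒳 → 𝒜} (ho : ∀ x, μ ∈ greedyRegion x (o x)) (n : ℕ) :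
    P.real {ω | G (n + 1) ω ≠ o (X (n + 1) ω)} ≤
      ∑ i, P.real {ω | δ * visits (fun s => (X s ω, A s ω)) n i ≤
        |noiseSum μ (fun s => (X s ω, A s ω)) (fun s => Y s ω) n i|} := by
  refine le_trans ?_ (measureReal_iUnion_fintype_le _)
  refine ENNReal.toReal_mono (measure_ne_top _ _) (measure_mono_ae ?_)
  filter_upwards [h.estimate n, h.greedy n] with ω h1 h2 hne
  by_contra hgood
  have := estimate_mem_robustParameterRegion hΦ hδ hcell (ho (X (n + 1) ω))
    (fun i => lt_of_not_ge fun hi => hgood (Set.mem_iUnion.2 ⟨i, hi⟩)) h1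
  exact (h2 (o (X (n + 1) ω))).not_gt (this _ hne)

variable [DiscreteMeasurableSpace 𝒜]

theorem measurableSet_arm (h : IsEpsGreedyRun P ℱ Φ μ p R ε X A Y θ G) (n : ℕ) (a : 𝒜) :
    MeasurableSet (A (n + 1) ⁻¹' {a}) :=
  ℱ.le _ _ (h.measurable_arm n (.of_discrete))

variable [DiscreteMeasurableSpace 𝒳]

theorem measurable_tilt [DecidableEq 𝒳] (h : IsEpsGreedyRun P ℱ Φ μ p R ε X A Y θ G)
    (δ l : ℝ) (i : 𝒳 × 𝒜) (n : ℕ) :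
    Measurable[ℱ n] fun ω => tilt μ δ l (fun s => (X s ω, A s ω)) (fun s => Y s ω) n i := by
  unfold tilt
  refine Finset.measurable_sum _ fun s hs => ?_
  obtain ⟨h1, h2⟩ := Finset.mem_Icc.1 hs
  obtain ⟨k, rfl⟩ : ∃ k, s = k + 1 := ⟨s - 1, by omega⟩
  refine Measurable.mono ?_ (ℱ.mono h2) le_rfl
  refine Measurable.ite ?_ ?_ measurable_const
  · convert (h.measurable_context k (.of_discrete (s := {i.1}))).inter
      (h.measurable_arm k (.of_discrete (s := {i.2}))) using 1
    ext ω
    simp [Prod.ext_iff]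
  · exact (((h.measurable_reward k).sub_const _).const_mul _).sub_const _

variable [IsProbabilityMeasure P]

/-- Every context-arm pair is explored, whatever the past. -/
theorem exploration_le (h : IsEpsGreedyRun P ℱ Φ μ p R ε X A Y θ G)
    {n : ℕ} (hε1 : ε (n + 1) ≤ 1) (i : 𝒳 × 𝒜) {s : Set Ω}
    (hs : MeasurableSet[ℱ n] s) :
    p i.1 * (ε (n + 1) / Fintype.card 𝒜) * P.real s ≤
      P.real (s ∩ {ω | (X (n + 1) ω, A (n + 1) ω) = i}) := by
  have hsX : MeasurableSet[infoBeforeAction ℱ X n] (s ∩ X (n + 1) ⁻¹' {i.1}) :=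
    MeasurableSet.inter ((le_sup_left : ℱ n ≤ infoBeforeAction ℱ X n) _ hs)
      ((le_sup_right : MeasurableSpace.comap (X (n + 1)) inferInstance ≤ infoBeforeAction ℱ X n)
        _ ⟨{i.1}, .of_discrete, rfl⟩)
  have hind : P.real (s ∩ X (n + 1) ⁻¹' {i.1}) = p i.1 * P.real s := by
    rw [Set.inter_comm, ← h.context_law n i.1, measureReal_def,
      (Indep_iff _ _ _).1 (h.context_indep n) _ _ ⟨{i.1}, .of_discrete, rfl⟩ hs,
      ENNReal.toReal_mul]
    rfl
  have hle := mul_measureReal_le_of_le_condExp (h.infoBeforeAction_le n)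
    -- Only the uniform part of the arm law is kept; the greedy part is nonnegative.
    (h.measurableSet_arm n i.2) hsX (c := ε (n + 1) / Fintype.card 𝒜) (by
      filter_upwards [h.arm_law n i.2] with ω hω _
      rw [hω]
      have : 0 ≤ (1 - ε (n + 1)) * (if G (n + 1) ω = i.2 then (1 : ℝ) else 0) :=
        mul_nonneg (by linarith) (by split_ifs <;> norm_num)
      linarith)
  rw [hind] at hle
  have hset : s ∩ X (n + 1) ⁻¹' {i.1} ∩ A (n + 1) ⁻¹' {i.2} =
      s ∩ {ω | (X (n + 1) ω, A (n + 1) ω) = i} := by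
    ext ω
    simp [Prod.ext_iff, and_assoc]
  rw [hset] at hle
  linarith

/-- One-step contraction. At least a fraction `q` of the mass of `f` sits where `i` is visited and
is multiplied there by at most `b ≤ 1`; the rest is unchanged. The total factor is at most `1 - q *
(1 - b) ≤ exp (-(q * (1 - b)))`. -/
theorem lintegral_step_le [DecidableEq 𝒳] (h : IsEpsGreedyRun P ℱ Φ μ p R ε X A Y θ G)
    {n : ℕ} (hε0 : 0 ≤ ε (n + 1)) (hε1 : ε (n + 1) ≤ 1) (i : 𝒳 × 𝒜) (hp : 0 ≤ p i.1)
    {δ l : ℝ} (hl : l ^ 2 * R ^ 2 / 2 ≤ |l| * δ)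
    {f : Ω → ENNReal} (hf : Measurable[ℱ n] f) (hfin : ∫⁻ ω, f ω ∂P ≠ ⊤) :
    ∫⁻ ω, f ω * ENNReal.ofReal (Real.exp (if (X (n + 1) ω, A (n + 1) ω) = i then
        l * (Y (n + 1) ω - μ i) - |l| * δ else 0)) ∂P ≤
      ENNReal.ofReal (Real.exp (-(p i.1 * (ε (n + 1) / Fintype.card 𝒜) *
        (1 - Real.exp (l ^ 2 * R ^ 2 / 2 - |l| * δ))))) * ∫⁻ ω, f ω ∂P := by
  set B : Set Ω := {ω | (X (n + 1) ω, A (n + 1) ω) = i} with hBdef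
  set q : ℝ := p i.1 * (ε (n + 1) / Fintype.card 𝒜) with hq
  set b : ℝ := Real.exp (l ^ 2 * R ^ 2 / 2 - |l| * δ) with hb
  have hq0 : 0 ≤ q := by positivity
  have hb1 : b ≤ 1 := Real.exp_le_one_iff.2 (by linarith)
  have hb0 : 0 ≤ b := (Real.exp_pos _).le
  have hBr : MeasurableSet[infoBeforeReward ℱ X A n] B := measurableSet_pair ℱ X A n i
  have hB : MeasurableSet B := h.infoBeforeReward_le n _ hBr
  have hfr : Measurable[infoBeforeReward ℱ X A n] f :=
    hf.mono (le_sup_left.trans le_sup_left) le_rfl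
  have hexplore : ENNReal.ofReal q * ∫⁻ ω, f ω ∂P ≤ ∫⁻ ω in B, f ω ∂P :=
    mul_lintegral_le_setLIntegral (ℱ.le n) hq0
      (fun s hs => h.exploration_le hε1 i hs) hf
  have hon : ∫⁻ ω in B, f ω * ENNReal.ofReal (Real.exp (if (X (n + 1) ω, A (n + 1) ω) = i then
        l * (Y (n + 1) ω - μ i) - |l| * δ else 0)) ∂P ≤
      ENNReal.ofReal b * ∫⁻ ω in B, f ω ∂P := by
    obtain ⟨hint, hsub⟩ := h.reward_law n l
    have := lintegral_mul_le_of_condExp_le (h.infoBeforeReward_le n) hint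
      (fun ω => (Real.exp_pos _).le) hsub (hfr.indicator hBr)
    calc _ = ∫⁻ ω in B, ENNReal.ofReal (Real.exp (-(|l| * δ))) * (f ω * ENNReal.ofReal
            (Real.exp (l * (Y (n + 1) ω - μ (X (n + 1) ω, A (n + 1) ω))))) ∂P := by
          refine setLIntegral_congr_fun hB fun ω hω => ?_
          have hω' : (X (n + 1) ω, A (n + 1) ω) = i := hω
          simp only [hω', if_true]
          rw [mul_left_comm, ← ENNReal.ofReal_mul (Real.exp_pos _).le, ← Real.exp_add,
            neg_add_eq_sub]
      _ = ENNReal.ofReal (Real.exp (-(|l| * δ))) * ∫⁻ ω, B.indicator f ω * ENNReal.ofReal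
            (Real.exp (l * (Y (n + 1) ω - μ (X (n + 1) ω, A (n + 1) ω)))) ∂P := by
          rw [lintegral_const_mul' _ _ ENNReal.ofReal_ne_top, ← lintegral_indicator hB]
          congr 1
          refine lintegral_congr fun ω => ?_
          by_cases hω : ω ∈ B <;> simp [hω]
      _ ≤ ENNReal.ofReal (Real.exp (-(|l| * δ))) *
            (ENNReal.ofReal (Real.exp (l ^ 2 * R ^ 2 / 2)) * ∫⁻ ω, B.indicator f ω ∂P) := by
          gcongr
      _ = _ := by
          rw [← mul_assoc, ← ENNReal.ofReal_mul (Real.exp_pos _).le, ← Real.exp_add,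
            neg_add_eq_sub, lintegral_indicator hB]
  have hoff : ∫⁻ ω in Bᶜ, f ω * ENNReal.ofReal (Real.exp (if (X (n + 1) ω, A (n + 1) ω) = i then
        l * (Y (n + 1) ω - μ i) - |l| * δ else 0)) ∂P = ∫⁻ ω in Bᶜ, f ω ∂P := by
    refine setLIntegral_congr_fun hB.compl fun ω hω => ?_
    have hω' : (X (n + 1) ω, A (n + 1) ω) ≠ i := hω
    simp [hω']
  rw [← lintegral_add_compl _ hB, hoff]
  refine (add_le_add_left hon _).trans ?_
  have hsum := lintegral_add_compl (μ := P) f hB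
  have hfin' := hfin
  rw [← hsum, ENNReal.add_ne_top] at hfin'
  -- The factor `1 - q * (1 - b)` involves subtraction, so the finite integrals are moved to the
  -- reals.
  lift (∫⁻ ω in B, f ω ∂P) to NNReal using hfin'.1 with u hu
  lift (∫⁻ ω in Bᶜ, f ω ∂P) to NNReal using hfin'.2 with v hv
  lift (∫⁻ ω, f ω ∂P) to NNReal using hfin with w hw
  have hsum' : (u : ℝ) + v = w := by exact_mod_cast hsum
  rw [← ENNReal.ofReal_coe_nnreal (p := w), ← ENNReal.ofReal_coe_nnreal (p := u),
    ← ENNReal.ofReal_mul hq0,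
      ENNReal.ofReal_le_ofReal_iff u.coe_nonneg] at hexplore
  rw [← ENNReal.ofReal_coe_nnreal (p := w), ← ENNReal.ofReal_coe_nnreal (p := u),
    ← ENNReal.ofReal_coe_nnreal (p := v), ← ENNReal.ofReal_mul hb0,
    ← ENNReal.ofReal_add (mul_nonneg hb0 u.coe_nonneg) v.coe_nonneg, ← ENNReal.ofReal_mul (Real.exp_pos _).le]
  refine ENNReal.ofReal_le_ofReal ?_
  have h1 : 1 - q * (1 - b) ≤ Real.exp (-(q * (1 - b))) := by
    have := Real.add_one_le_exp (-(q * (1 - b)))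
    linarith
  have h2 := mul_le_mul_of_nonneg_right h1 w.coe_nonneg
  have h3 := mul_le_mul_of_nonneg_right hexplore (sub_nonneg.2 hb1)
  nlinarith

theorem lintegral_exp_tilt_le [DecidableEq 𝒳] (h : IsEpsGreedyRun P ℱ Φ μ p R ε X A Y θ G)
    (hε0 : ∀ n, 0 ≤ ε (n + 1)) (hε1 : ∀ n, ε (n + 1) ≤ 1) (i : 𝒳 × 𝒜) (hp : 0 ≤ p i.1)
    {δ l : ℝ} (hl : l ^ 2 * R ^ 2 / 2 ≤ |l| * δ) (n : ℕ) :
    ∫⁻ ω, ENNReal.ofReal (Real.exp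
        (tilt μ δ l (fun s => (X s ω, A s ω)) (fun s => Y s ω) n i)) ∂P ≤
      ENNReal.ofReal (Real.exp (-(p i.1 / Fintype.card 𝒜 *
        (1 - Real.exp (l ^ 2 * R ^ 2 / 2 - |l| * δ)) * ∑ s ∈ Finset.Icc 1 n, ε s))) := by
  induction n with
  | zero => simp [tilt]
  | succ n ih =>
    have hstep := h.lintegral_step_le (hε0 n) (hε1 n) i hp hl
      (h.measurable_tilt δ l i n).exp.ennreal_ofReal (ih.trans_lt ENNReal.ofReal_lt_top).ne
    calc _ = _ := lintegral_congr fun ω => by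
          rw [← ENNReal.ofReal_mul (Real.exp_pos _).le, ← Real.exp_add, tilt, tilt,
            Finset.sum_Icc_succ_top (by omega)]
      _ ≤ _ := hstep
      _ ≤ _ := mul_le_mul_right ih _
      _ = _ := by
          rw [← ENNReal.ofReal_mul (Real.exp_pos _).le, ← Real.exp_add,
            Finset.sum_Icc_succ_top (by omega)]
          ring_nf

/-- The probability that, after `n` rounds, the empirical mean of `i` is off by `δ` or more, or
that `i` has not been observed yet. -/
theorem measureReal_deviation_le [DecidableEq 𝒳]
    (h : IsEpsGreedyRun P ℱ Φ μ p (1 / 2) ε X A Y θ G)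
    (hε0 : ∀ n, 0 ≤ ε (n + 1)) (hε1 : ∀ n, ε (n + 1) ≤ 1) (i : 𝒳 × 𝒜) (hp : 0 ≤ p i.1)
    {δ : ℝ} (hδ : 0 < δ) (n : ℕ) :
    P.real {ω | δ * visits (fun s => (X s ω, A s ω)) n i ≤
        |noiseSum μ (fun s => (X s ω, A s ω)) (fun s => Y s ω) n i|} ≤
      2 * Real.exp (-(p i.1 / Fintype.card 𝒜 * (1 - Real.exp (-(2 * δ ^ 2))) *
        ∑ s ∈ Finset.Icc 1 n, ε s)) := by
  set E : ℝ := Real.exp (-(p i.1 / Fintype.card 𝒜 * (1 - Real.exp (-(2 * δ ^ 2))) *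
        ∑ s ∈ Finset.Icc 1 n, ε s)) with hE
  have key : ∀ l : ℝ, |l| = 4 * δ → P.real {ω | 0 ≤
      tilt μ δ l (fun s => (X s ω, A s ω)) (fun s => Y s ω) n i} ≤ E := by
    -- `|l| = 4 * δ` minimizes `l ^ 2 / 8 - |l| * δ`, with value `-2 * δ ^ 2`. What follows is
    -- Markov's inequality at level `1`.
    intro l hl
    have hl2 : l ^ 2 = 16 * δ ^ 2 := by rw [← sq_abs, hl]; ring
    have hexp : l ^ 2 * (1 / 2) ^ 2 / 2 - |l| * δ = -(2 * δ ^ 2) := by rw [hl2, hl]; ring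
    have hM := h.lintegral_exp_tilt_le hε0 hε1 i hp (δ := δ) (l := l) (by nlinarith) n
    rw [hexp, ← hE] at hM
    refine ENNReal.toReal_le_of_le_ofReal (Real.exp_pos _).le (le_trans ?_ hM)
    have hmeas : MeasurableSet {ω | 0 ≤
        tilt μ δ l (fun s => (X s ω, A s ω)) (fun s => Y s ω) n i} :=
      measurableSet_le measurable_const ((h.measurable_tilt δ l i n).mono (ℱ.le n) le_rfl)
    rw [← lintegral_indicator_one hmeas]
    refine lintegral_mono (Set.indicator_le fun ω hω => ?_)
    exact ENNReal.one_le_ofReal.2 (Real.one_le_exp hω)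
  -- The two signs of `l` cover the two signs of the deviation. An unvisited pair has tilt `0` and
  -- is covered as well.
  calc _ ≤ P.real ({ω | 0 ≤ tilt μ δ (4 * δ) (fun s => (X s ω, A s ω)) (fun s => Y s ω) n i} ∪
        {ω | 0 ≤ tilt μ δ (-(4 * δ)) (fun s => (X s ω, A s ω)) (fun s => Y s ω) n i}) := by
        refine measureReal_mono fun ω hω => ?_
        simp only [Set.mem_union, Set.mem_ofPred_eq, tilt_eq, abs_neg,
          abs_of_pos (by positivity : 0 < 4 * δ)] at hω ⊢
        rcases le_abs.1 hω with h1 | h1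
        · left; nlinarith
        · right; nlinarith
    _ ≤ _ := measureReal_union_le _ _
    _ ≤ E + E := add_le_add (key _ (abs_of_pos (by positivity)))
        (key _ (by rw [abs_neg, abs_of_pos (by positivity)]))
    _ = 2 * E := by ring


/-- When the greedy arm is optimal it is played with conditional probability at least `1 - ε`. The
event is sliced by the value of the greedy arm because the arm law concerns one fixed arm at a time.
-/
theorem measureReal_arm_ne_le (h : IsEpsGreedyRun P ℱ Φ μ p R ε X A Y θ G) {n : ℕ}
    (hε0 : 0 ≤ ε (n + 1)) (hε1 : ε (n + 1) ≤ 1) (o : 𝒳 → 𝒜) :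
    P.real {ω | A (n + 1) ω ≠ o (X (n + 1) ω)} ≤
      ε (n + 1) + P.real {ω | G (n + 1) ω ≠ o (X (n + 1) ω)} := by
  have hX : Measurable[infoBeforeAction ℱ X n] (X (n + 1)) :=
    (comap_measurable _).mono le_sup_right le_rfl
  set s : 𝒜 → Set Ω := fun a => {ω | G (n + 1) ω = a} ∩ {ω | o (X (n + 1) ω) = a} with hsdef
  have hs : ∀ a, MeasurableSet[infoBeforeAction ℱ X n] (s a) := fun a =>
    MeasurableSet.inter (h.measurable_greedy n (.of_discrete (s := {a})))
      (hX (.of_discrete (s := o ⁻¹' {a})))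
  have hmeas : ∀ a, MeasurableSet (s a) := fun a => h.infoBeforeAction_le n _ (hs a)
  have hstep : ∀ a, (1 - ε (n + 1)) * P.real (s a) ≤ P.real (s a ∩ A (n + 1) ⁻¹' {a}) := by
    intro a
    refine mul_measureReal_le_of_le_condExp (h.infoBeforeAction_le n) (h.measurableSet_arm n a)
      (hs a) ?_
    filter_upwards [h.arm_law n a] with ω hω hmem
    have hGa : G (n + 1) ω = a := hmem.1
    rw [hω, if_pos hGa, mul_one]
    have : 0 ≤ ε (n + 1) / Fintype.card 𝒜 := by positivity
    linarith
  have hG : {ω | G (n + 1) ω = o (X (n + 1) ω)} = ⋃ a, s a := by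
    ext ω; simp [hsdef, eq_comm]
  have hGm : MeasurableSet {ω | G (n + 1) ω = o (X (n + 1) ω)} :=
    hG ▸ MeasurableSet.iUnion hmeas
  have hA : {ω | A (n + 1) ω = o (X (n + 1) ω)} =
      ⋃ a, {ω | o (X (n + 1) ω) = a} ∩ A (n + 1) ⁻¹' {a} := by
    ext ω; simp
  have hAm : MeasurableSet {ω | A (n + 1) ω = o (X (n + 1) ω)} := by
    rw [hA]
    exact MeasurableSet.iUnion fun a =>
      (h.infoBeforeAction_le n _ (hX (.of_discrete (s := o ⁻¹' {a})))).inter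
        (h.measurableSet_arm n a)
  have hle : (1 - ε (n + 1)) * P.real {ω | G (n + 1) ω = o (X (n + 1) ω)} ≤
      P.real {ω | A (n + 1) ω = o (X (n + 1) ω)} := by
    calc _ ≤ (1 - ε (n + 1)) * ∑ a, P.real (s a) := by
          rw [hG]
          exact mul_le_mul_of_nonneg_left (measureReal_iUnion_fintype_le _) (by linarith)
      _ ≤ ∑ a, P.real (s a ∩ A (n + 1) ⁻¹' {a}) := by
          rw [Finset.mul_sum]
          exact Finset.sum_le_sum fun a _ => hstep a
      _ = P.real (⋃ a, s a ∩ A (n + 1) ⁻¹' {a}) := by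
          rw [measureReal_iUnion_fintype]
          · intro a b hab
            refine Set.disjoint_left.2 fun ω h1 h2 => hab ?_
            exact h1.2.symm.trans h2.2
          · exact fun a => (hmeas a).inter (h.measurableSet_arm n a)
      _ ≤ _ := by
          rw [hA]
          exact measureReal_mono (Set.iUnion_mono fun a =>
            Set.inter_subset_inter_left _ Set.inter_subset_right)
  have h1 := probReal_compl_eq_one_sub (μ := P) hGm
  have h2 := probReal_compl_eq_one_sub (μ := P) hAm
  have h3 : P.real {ω | G (n + 1) ω = o (X (n + 1) ω)} ≤ 1 := measureReal_le_one
  change P.real {ω | A (n + 1) ω = o (X (n + 1) ω)}ᶜ ≤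
    ε (n + 1) + P.real {ω | G (n + 1) ω = o (X (n + 1) ω)}ᶜ
  rw [h1, h2]
  nlinarith

theorem integral_gap_le [Finite 𝒳] (h : IsEpsGreedyRun P ℱ Φ μ p R ε X A Y θ G) {n : ℕ}
    {o : 𝒳 → 𝒜} (ho : ∀ x, μ ∈ greedyRegion x (o x)) :
    ∫ ω, gap μ (X (n + 1) ω) (A (n + 1) ω) ∂P ≤
      maxGap μ * P.real {ω | A (n + 1) ω ≠ o (X (n + 1) ω)} := by
  have hmeas : MeasurableSet {ω | A (n + 1) ω ≠ o (X (n + 1) ω)} :=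
    (measurableSet_eq_fun ((h.measurable_arm n).mono (ℱ.le _) le_rfl)
      (Measurable.of_discrete.comp ((h.measurable_context n).mono (ℱ.le _) le_rfl))).compl
  calc _ ≤ ∫ ω, {ω | A (n + 1) ω ≠ o (X (n + 1) ω)}.indicator (fun _ => maxGap μ) ω ∂P := by
        refine integral_mono_of_nonneg (.of_forall fun ω => gap_nonneg μ _ _)
          ((integrable_const _).indicator hmeas) (.of_forall fun ω => ?_)
        by_cases hω : A (n + 1) ω = o (X (n + 1) ω)
        · simp [hω, gap_eq_zero (ho _)]
        · simp only [Set.indicator, Set.mem_ofPred_eq, ne_eq, hω, not_false_eq_true, if_true]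
          exact gap_le_maxGap μ _ _
    _ = _ := by rw [integral_indicator_const _ hmeas, smul_eq_mul, mul_comm]

end IsEpsGreedyRun

end Run

/-! ### Sums of inverse square roots. -/

section Sums

/-- Telescoping of `√(k + 1) - √k ≤ 1 / √k`. -/
theorem sqrt_sub_one_le_sum (n : ℕ) :
    √((n + 1 : ℕ) : ℝ) - 1 ≤ ∑ s ∈ Finset.Icc 1 n, 1 / √(s : ℝ) := by
  induction n with
  | zero => simp
  | succ n ih =>
    rw [Finset.sum_Icc_succ_top (by omega)]
    have h0 : 0 < √((n + 1 : ℕ) : ℝ) := Real.sqrt_pos.2 (by positivity)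
    have h1 := Real.sq_sqrt (Nat.cast_nonneg (α := ℝ) (n + 1))
    have h2 := Real.sq_sqrt (Nat.cast_nonneg (α := ℝ) (n + 1 + 1))
    have h3 : √((n + 1 : ℕ) : ℝ) ≤ √((n + 1 + 1 : ℕ) : ℝ) :=
      Real.sqrt_le_sqrt (by push_cast; linarith)
    have h4 : √((n + 1 + 1 : ℕ) : ℝ) - √((n + 1 : ℕ) : ℝ) ≤ 1 / √((n + 1 : ℕ) : ℝ) := by
      rw [le_div_iff₀ h0]
      push_cast at h1 h2 h3 h0 ⊢
      nlinarith
    linarith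

theorem sum_one_div_sqrt_le (n : ℕ) :
    ∑ s ∈ Finset.Icc 1 n, 1 / √(s : ℝ) ≤ 2 * √(n : ℝ) := by
  induction n with
  | zero => simp
  | succ n ih =>
    rw [Finset.sum_Icc_succ_top (by omega)]
    have h0 : 0 < √((n + 1 : ℕ) : ℝ) := Real.sqrt_pos.2 (by positivity)
    have h1 := Real.sq_sqrt (Nat.cast_nonneg (α := ℝ) (n + 1))
    have h2 := Real.sq_sqrt (Nat.cast_nonneg (α := ℝ) n)
    have h4 : 1 / √((n + 1 : ℕ) : ℝ) ≤ 2 * (√((n + 1 : ℕ) : ℝ) - √(n : ℝ)) := by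
      rw [div_le_iff₀ h0]
      push_cast at h1 h2 h0 ⊢
      nlinarith [sq_nonneg (√((n : ℝ) + 1) - √(n : ℝ))]
    linarith

/-- The bound `u ≤ exp u` at `u = c * √(n + 1)` gives up most of the decay, but what is left matches
the exploration rate of round `n + 1`. -/
theorem exp_neg_mul_sum_le {c : ℝ} (hc : 0 < c) (n : ℕ) :
    Real.exp (-(c * ∑ s ∈ Finset.Icc 1 n, 1 / √(s : ℝ))) ≤
      Real.exp c / c * (1 / √((n + 1 : ℕ) : ℝ)) := by
  have h0 : 0 < √((n + 1 : ℕ) : ℝ) := Real.sqrt_pos.2 (by positivity)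
  calc _ ≤ Real.exp (c + -(c * √((n + 1 : ℕ) : ℝ))) := by
        refine Real.exp_le_exp.2 ?_
        have := mul_le_mul_of_nonneg_left (sqrt_sub_one_le_sum n) hc.le
        linarith
    _ = Real.exp c * (Real.exp (c * √((n + 1 : ℕ) : ℝ)))⁻¹ := by rw [Real.exp_add, Real.exp_neg]
    _ ≤ Real.exp c * (c * √((n + 1 : ℕ) : ℝ))⁻¹ := by
        gcongr
        linarith [Real.add_one_le_exp (c * √((n + 1 : ℕ) : ℝ))]
    _ = _ := by field_simp

end Sums

end ContextBandit

/-! ### The regret bound. -/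

theorem mainTheorem5 {𝒳 𝒜 : Type*}
    [Fintype 𝒳] [DecidableEq 𝒳] [MeasurableSpace 𝒳] [DiscreteMeasurableSpace 𝒳]
    [Fintype 𝒜] [DecidableEq 𝒜] [MeasurableSpace 𝒜] [DiscreteMeasurableSpace 𝒜]
    (p : 𝒳 → ℝ) (hp_pos : ∀ x, 0 < p x) (hp_sum : ∑ x, p x = 1) :
    ∃ C : ℝ → ℝ,
      ∀ (d : ℕ) (Φ : Matrix (𝒳 × 𝒜) (Fin d) ℝ),
      Submodule.span ℝ (Set.range Φ.row) = ⊤ →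
      ∀ μ ∈ ContextBandit.robustInterior Φ,
      ∀ δ : ℝ, 0 < δ → ContextBandit.cell μ δ ⊆ ContextBandit.robustRegion Φ →
      ∀ (Ω : Type*) [mΩ : MeasurableSpace Ω] (P : Measure Ω) [IsProbabilityMeasure P]
        (ℱ : Filtration ℕ mΩ) (X : ℕ → Ω → 𝒳) (A : ℕ → Ω → 𝒜) (Y : ℕ → Ω → ℝ)
        (θ : ℕ → Ω → (Fin d → ℝ)) (G : ℕ → Ω → 𝒜),
        ContextBandit.IsEpsGreedyRun P ℱ Φ μ p (1 / 2) (fun t => 1 / √(t : ℝ)) X A Y θ G →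
        ∀ T : ℕ,
          ContextBandit.regret P μ X A T ≤ C δ * ContextBandit.maxGap μ * √(T : ℝ) := by
  set c : ℝ → 𝒳 × 𝒜 → ℝ := fun δ i =>
    p i.1 / Fintype.card 𝒜 * (1 - Real.exp (-(2 * δ ^ 2))) with hc
  -- The outer `2` comes from `∑ 1 / √t ≤ 2 * √T`, the `1` from exploration, and the sum from the
  -- union bound over pairs, its inner `2` from the two signs of the deviation.
  refine ⟨fun δ => 2 * (1 + ∑ i, 2 * (Real.exp (c δ i) / c δ i)), ?_⟩
  intro d Φ hΦ μ _ δ hδ hcell Ω mΩ P _ ℱ X A Y θ G h T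
  have hopt : ∀ x, ∃ a, μ ∈ ContextBandit.greedyRegion x a := fun x => by
    obtain ⟨a, ha, -⟩ := Set.mem_iUnion.1
      (Set.mem_iInter.1 (hcell (ContextBandit.mem_cell_self μ hδ)) x)
    exact ⟨a, ha⟩
  choose o ho using hopt
  have hcpos : ∀ i, 0 < c δ i := fun i => by
    have h1 : 0 < (Fintype.card 𝒜 : ℝ) := by exact_mod_cast Fintype.card_pos_iff.2 ⟨i.2⟩
    have h2 : Real.exp (-(2 * δ ^ 2)) < 1 := by
      rw [← Real.exp_zero]
      exact Real.exp_lt_exp.2 (by nlinarith)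
    exact mul_pos (div_pos (hp_pos _) h1) (by linarith)
  have hε0 : ∀ n : ℕ, 0 ≤ 1 / √((n + 1 : ℕ) : ℝ) := fun n => by positivity
  have hε1 : ∀ n : ℕ, 1 / √((n + 1 : ℕ) : ℝ) ≤ 1 := fun n => by
    have : 1 ≤ √((n + 1 : ℕ) : ℝ) :=
      Real.one_le_sqrt.2 (by push_cast; linarith [n.cast_nonneg (α := ℝ)])
    exact div_le_one_of_le₀ this (by positivity)
  have hround : ∀ t ∈ Finset.Icc 1 T, ∫ ω, ContextBandit.gap μ (X t ω) (A t ω) ∂P ≤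
      ContextBandit.maxGap μ * (1 + ∑ i, 2 * (Real.exp (c δ i) / c δ i)) * (1 / √(t : ℝ)) := by
    intro t ht
    obtain ⟨n, rfl⟩ : ∃ n, t = n + 1 := ⟨t - 1, by have := (Finset.mem_Icc.1 ht).1; omega⟩
    have h1 := h.integral_gap_le (n := n) ho
    have h2 := h.measureReal_arm_ne_le (hε0 n) (hε1 n) o
    have h3 := h.measureReal_greedy_ne_le hΦ hδ hcell ho n
    have h4 := Finset.sum_le_sum fun i (_ : i ∈ Finset.univ) =>
      (h.measureReal_deviation_le hε0 hε1 i (hp_pos i.1).le hδ n).trans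
        (mul_le_mul_of_nonneg_left
          (ContextBandit.exp_neg_mul_sum_le (hcpos i) n) zero_le_two)
    have h5 : ∑ i, 2 * (Real.exp (c δ i) / c δ i * (1 / √((n + 1 : ℕ) : ℝ))) =
        (∑ i, 2 * (Real.exp (c δ i) / c δ i)) * (1 / √((n + 1 : ℕ) : ℝ)) := by
      rw [Finset.sum_mul]
      exact Finset.sum_congr rfl fun i _ => by ring
    rw [h5] at h4
    rw [mul_assoc]
    refine h1.trans (mul_le_mul_of_nonneg_left ?_ (ContextBandit.maxGap_nonneg μ))
    linarith
  have hK : 0 ≤ 1 + ∑ i, 2 * (Real.exp (c δ i) / c δ i) :=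
    add_nonneg zero_le_one (Finset.sum_nonneg fun i _ =>
      mul_nonneg zero_le_two (div_nonneg (Real.exp_pos _).le (hcpos i).le))
  calc _ ≤ ∑ t ∈ Finset.Icc 1 T, ContextBandit.maxGap μ *
        (1 + ∑ i, 2 * (Real.exp (c δ i) / c δ i)) * (1 / √(t : ℝ)) := Finset.sum_le_sum hround
    _ ≤ ContextBandit.maxGap μ * (1 + ∑ i, 2 * (Real.exp (c δ i) / c δ i)) * (2 * √(T : ℝ)) := by
        rw [← Finset.mul_sum]
        exact mul_le_mul_of_nonneg_left (ContextBandit.sum_one_div_sqrt_le T)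
          (mul_nonneg (ContextBandit.maxGap_nonneg μ) hK)
    _ = _ := by ring
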